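/- All logarithms are to base $2$. Let $\mathcal Z$ be a finite set and let $P,Q$ be probability mass functions on $\mathcal Z$ with $P\ll Q$ (that is, $Q(z)=0$ implies $P(z)=0$). Put $$D(P\|Q)=\sum_{z} P(z)\log\frac{P(z)}{Q(z)},\qquad V(P\|Q)=\sum_{z} P(z)\Big[\log\frac{P(z)}{Q(z)}-D(P\|Q)\Big]^2,$$ where terms with $P(z)=0$ are read as $0$, and assume $V(P\|Q)>0$. For $n\in\mathbb N$ let $P^n(\mathbf z)=\prod_{i=1}^n P(z_i)$ and $Q^n(\mathbf z)=\prod_{i=1}^n Q(z_i)$ be the product distributions on $\mathcal Z^n$. For $\varepsilon\in(0,1)$ and distributions $P',Q'$ on a finite set $\mathcal Z'$ let $$\beta_{1-\varepsilon}(P',Q')=\inf\Big\{\sum_{z}Q'(z)(1-\delta(z)) : \delta:\mathcal Z'\to[0,1],\ \sum_z P'(z)\delta(z)\le\varepsilon\Big\},\qquad D_{\mathrm h}^{\varepsilon}(P'\|Q')=-\log\frac{\beta_{1-\varepsilon}(P',Q')}{1-\varepsilon}.$$ Let $\Phi$ be the standard Gaussian cumulative distribution function and $\Phi^{-1}(\varepsilon)=\sup\{y\in\mathbb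 R:\Phi(y)\le\varepsilon\}$ its inverse. Then for every fixed $\varepsilon\in(0,1)$ one has $\beta_{1-\varepsilon}(P^n,Q^n)>0$ for all $n$ (so $D_{\mathrm h}^{\varepsilon}(P^n\|Q^n)$ is finite), and, as $n\to\infty$, $$D_{\mathrm h}^{\varepsilon}(P^n\|Q^n)=nD(P\|Q)+\sqrt{nV(P\|Q)}\,\Phi^{-1}(\varepsilon)+\tfrac12\log n+O(1),$$ where the $O(1)$ term is bounded in $n$ (by a constant that may depend on $P,Q,\varepsilon$). Consequently (Chernoff–Stein lemma), $$\lim_{n\to\infty}\frac1n\log\frac1{\beta_{1-\varepsilon}(P^n,Q^n)}=\lim_{n\to\infty}\frac{D_{\mathrm h}^{\varepsilon}(P^n\|Q^n)}{n}=D(P\|Q).$$ -/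

import Mathlib

open Filter Topology Asymptotics

noncomputable section

namespace HypothesisTesting

/-- Relative entropy `D(P‖Q)` of two probability mass functions on a finite alphabet, in bits.
For `P ≪ Q` the conventions `0 * x = 0` and `x / 0 = 0` only affect terms with `P z = 0`, which
contribute `0` as usual. -/
def relEntropy {Z : Type*} [Fintype Z] (P Q : Z → ℝ) : ℝ :=
  ∑ z, P z * Real.logb 2 (P z / Q z)

/-- Relative entropy variance `V(P‖Q)`: the variance under `P` of the (base 2) log-likelihood
ratio. -/
def relEntropyVariance {Z : Type*} [Fintype Z] (P Q : Z → ℝ) : ℝ :=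
  ∑ z, P z * (Real.logb 2 (P z / Q z) - relEntropy P Q) ^ 2

/-- The `n`-fold product distribution `Pⁿ` on `Zⁿ`. -/
def prodDist {Z : Type*} (P : Z → ℝ) (n : ℕ) : (Fin n → Z) → ℝ :=
  fun z => ∏ i, P (z i)

/-- Randomized tests `δ : Z → [0,1]` whose false-alarm probability (type-I error)
`E_P[δ(Z)]` is at most `ε`. -/
def admissibleTests {Z : Type*} [Fintype Z] (ε : ℝ) (P : Z → ℝ) : Set (Z → ℝ) :=
  {δ | (∀ z, δ z ∈ Set.Icc (0 : ℝ) 1) ∧ ∑ z, P z * δ z ≤ ε}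

/-- `β_{1-ε}(P,Q)`: the infimum of the missed-detection probability (type-II error)
`E_Q[1 - δ(Z)]` over all randomized tests with type-I error at most `ε`. -/
def minTypeTwoError {Z : Type*} [Fintype Z] (ε : ℝ) (P Q : Z → ℝ) : ℝ :=
  sInf ((fun δ : Z → ℝ => ∑ z, Q z * (1 - δ z)) '' admissibleTests ε P)

/-- The `ε`-hypothesis-testing divergence
`D_h^ε(P‖Q) = -log₂ (β_{1-ε}(P,Q) / (1-ε))`, real-valued whenever `β_{1-ε}(P,Q) > 0`. -/
def hypTestDiv {Z : Type*} [Fintype Z] (ε : ℝ) (P Q : Z → ℝ) : ℝ :=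
  -Real.logb 2 (minTypeTwoError ε P Q / (1 - ε))

/-- The standard Gaussian cumulative distribution function `Φ`. -/
def gaussianCDF (y : ℝ) : ℝ :=
  ProbabilityTheory.cdf (ProbabilityTheory.gaussianReal 0 1) y

/-- The inverse `Φ⁻¹(ε) = sup {y : Φ(y) ≤ ε}`, the usual inverse function for `ε ∈ (0,1)`. -/
def gaussianCDFInv (ε : ℝ) : ℝ :=
  sSup {y : ℝ | gaussianCDF y ≤ ε}

end HypothesisTesting

end

/-!
The optimal type-II error is governed by the law, under `Pⁿ`, of the log-likelihood ratio
`L = ∑ log₂ (P(Zᵢ)/Q(Zᵢ))`, a sum of independent bounded terms with mean `D(P‖Q)` and variance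
`V(P‖Q)`. Since `Qⁿ = 2^{-L} Pⁿ` on the support of `Pⁿ`, two bounds enclose `β`:

* every test satisfies `β ≥ 2^{-γ} (Pⁿ[L < γ] - ε)` for every `γ` (`le_minTypeTwoError`);
* if `Pⁿ[L < γ] ≤ ε`, the test with threshold `γ` gives `β ≤ 2 p 2^{-γ}`, where `p` bounds the
  probability that `L` lies in an interval of length one (`minTypeTwoError_le`).

By the Berry–Esseen theorem `Pⁿ[L < n D + √(n V) x] = Φ(x) + O(n^{-1/2})`. Displacing the threshold
`n D + √(n V) Φ⁻¹(ε)` by a large constant up or down changes this probability by more than the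
Berry–Esseen error, because `Φ' > 0`; so upwards it exceeds `ε` by `n^{-1/2}`, and downwards it is
at most `ε`. With `p = O(n^{-1/2})`, both bounds equal `2^{-γ} n^{-1/2}` up to a constant factor,
and the factor `n^{-1/2}` is the source of the term `½ log₂ n`
(`exists_abs_logb_minTypeTwoError_le`).

The Berry–Esseen theorem (`berry_esseen`) is proved by Stein's method, with expectations written as
finite sums. For a normalized sum `W = S + Y`, where `Y` is one of `n + 1` independent centred
letters, exchangeability gives `E[W F(W)] = (n + 1) E[Y (F(S + Y) - F(S))]` (`stein_identity`).
Applied to a clipped linear `F`, this bounds the probability that `S` lies in a short interval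
(`expect_indicator_Icc_le`), which also yields `p`. Applied to the solution `f` of
`f'(w) - w f(w) = 1{w < t} - Φ(t)`, it expresses `P[W < t] - Φ(t) = E[f'(W) - W f(W)]` through the
variation of `f'` at the scale of a single letter; `f'` is Lipschitz except for a jump at `t`, and
the jump is absorbed by the interval bound.
-/

namespace HypothesisTesting

/-! ### The standard Gaussian distribution function -/

section gaussian

open MeasureTheory ProbabilityTheory

/-- The standard Gaussian density `φ`. -/
noncomputable def gaussianDensity (x : ℝ) : ℝ := gaussianPDFReal 0 1 x

theorem gaussianDensity_pos (x : ℝ) : 0 < gaussianDensity x :=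
  gaussianPDFReal_pos 0 1 x one_ne_zero

theorem gaussianDensity_eq (x : ℝ) :
    gaussianDensity x = (√(2 * Real.pi))⁻¹ * Real.exp (-x ^ 2 / 2) := by
  simp [gaussianDensity, gaussianPDFReal]

theorem hasDerivAt_gaussianDensity (x : ℝ) :
    HasDerivAt gaussianDensity (-x * gaussianDensity x) x := by
  have h : HasDerivAt (fun x : ℝ => (√(2 * Real.pi))⁻¹ * Real.exp (-x ^ 2 / 2))
      ((√(2 * Real.pi))⁻¹ * (Real.exp (-x ^ 2 / 2) * (-(2 * x) / 2))) x := by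
    have h1 : HasDerivAt (fun x : ℝ => -x ^ 2 / 2) (-(2 * x) / 2) x := by
      simpa using ((hasDerivAt_pow 2 x).neg.div_const 2)
    exact h1.exp.const_mul _
  have he : gaussianDensity = fun x : ℝ => (√(2 * Real.pi))⁻¹ * Real.exp (-x ^ 2 / 2) :=
    funext gaussianDensity_eq
  rw [he]
  convert h using 1
  ring

theorem continuous_gaussianDensity : Continuous gaussianDensity :=
  continuous_iff_continuousAt.2 fun x => (hasDerivAt_gaussianDensity x).continuousAt

theorem gaussianDensity_anti_abs {x y : ℝ} (h : |x| ≤ |y|) :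
    gaussianDensity y ≤ gaussianDensity x := by
  rw [gaussianDensity_eq, gaussianDensity_eq]
  have := sq_le_sq.2 h
  gcongr

theorem integrable_gaussianDensity : Integrable gaussianDensity :=
  integrable_gaussianPDFReal 0 1

theorem gaussianCDF_eq_integral (x : ℝ) :
    gaussianCDF x = ∫ t in Set.Iic x, gaussianDensity t := by
  rw [gaussianCDF, cdf_eq_real, measureReal_def, gaussianReal_apply_eq_integral 0 one_ne_zero,
    ENNReal.toReal_ofReal]
  · rfl
  · exact integral_nonneg fun t => gaussianPDFReal_nonneg 0 1 t

theorem one_sub_gaussianCDF_eq_integral (x : ℝ) :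
    1 - gaussianCDF x = ∫ t in Set.Ioi x, gaussianDensity t := by
  have h := integral_add_compl (measurableSet_Iic (a := x)) integrable_gaussianDensity
  rw [Set.compl_Iic, ← gaussianCDF_eq_integral] at h
  have h1 : ∫ t, gaussianDensity t = 1 := integral_gaussianPDFReal_eq_one 0 one_ne_zero
  linarith

theorem hasDerivAt_gaussianCDF (x : ℝ) : HasDerivAt gaussianCDF (gaussianDensity x) x := by
  have h : gaussianCDF = fun y => (∫ t in (0 : ℝ)..y, gaussianDensity t) + gaussianCDF 0 := by
    funext y
    rw [gaussianCDF_eq_integral, gaussianCDF_eq_integral,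
      ← intervalIntegral.integral_Iic_sub_Iic integrable_gaussianDensity.integrableOn
        integrable_gaussianDensity.integrableOn]
    ring
  rw [h]
  exact (intervalIntegral.integral_hasDerivAt_right
    (integrable_gaussianDensity.intervalIntegrable)
    (continuous_gaussianDensity.stronglyMeasurableAtFilter _ _)
    continuous_gaussianDensity.continuousAt).add_const _

theorem continuous_gaussianCDF : Continuous gaussianCDF :=
  continuous_iff_continuousAt.2 fun x => (hasDerivAt_gaussianCDF x).continuousAt

theorem strictMono_gaussianCDF : StrictMono gaussianCDF :=
  strictMono_of_deriv_pos fun x => by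
    rw [(hasDerivAt_gaussianCDF x).deriv]; exact gaussianDensity_pos x

theorem gaussianCDF_nonneg (x : ℝ) : 0 ≤ gaussianCDF x := cdf_nonneg _ x

theorem gaussianCDF_le_one (x : ℝ) : gaussianCDF x ≤ 1 := cdf_le_one _ x

/-- `Φ⁻¹` as defined through a supremum is a genuine right inverse of `Φ` on `(0,1)`. -/
theorem gaussianCDF_gaussianCDFInv {ε : ℝ} (hε : ε ∈ Set.Ioo (0 : ℝ) 1) :
    gaussianCDF (gaussianCDFInv ε) = ε := by
  obtain ⟨a, ha⟩ := (((tendsto_cdf_atBot (gaussianReal 0 1)).eventually_lt_const hε.1)).exists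
  obtain ⟨b, hb⟩ := (((tendsto_cdf_atTop (gaussianReal 0 1)).eventually_const_lt hε.2)).exists
  obtain ⟨x, hx⟩ := mem_range_of_exists_le_of_exists_ge continuous_gaussianCDF
    ⟨a, ha.le⟩ ⟨b, hb.le⟩
  have h : {y : ℝ | gaussianCDF y ≤ ε} = Set.Iic x := by
    ext y
    simp only [Set.mem_ofPred_eq, Set.mem_Iic]
    rw [← hx, strictMono_gaussianCDF.le_iff_le]
  rw [gaussianCDFInv, h, csSup_Iic, hx]

/-- Mills' bound for the upper Gaussian tail: on `(x, ∞)` one has `x φ(t) ≤ t φ(t) = -φ'(t)`. -/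
theorem mul_one_sub_gaussianCDF_le (x : ℝ) : x * (1 - gaussianCDF x) ≤ gaussianDensity x := by
  have hd : ∀ t : ℝ, HasDerivAt (fun t => -gaussianDensity t) (t * gaussianDensity t) t := by
    intro t
    exact (hasDerivAt_gaussianDensity t).neg.congr_deriv (by ring)
  have hlim : Tendsto (fun t => -gaussianDensity t) atTop (𝓝 0) := by
    have h1 : Tendsto (fun t : ℝ => -t ^ 2 / 2) atTop atBot := by
      have : Tendsto (fun t : ℝ => t ^ 2 / 2) atTop atTop :=
        (tendsto_pow_atTop two_ne_zero).atTop_div_const two_pos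
      exact (tendsto_neg_atTop_atBot.comp this).congr fun t => (neg_div _ _).symm
    have h2 := ((Real.tendsto_exp_atBot.comp h1).const_mul ((√(2 * Real.pi))⁻¹)).neg
    simpa [Function.comp_def, gaussianDensity_eq] using h2
  rcases le_or_gt x 0 with hx | hx
  · have := gaussianCDF_le_one x
    have := gaussianDensity_pos x
    nlinarith
  · have hnn : ∀ t ∈ Set.Ioi x, 0 ≤ t * gaussianDensity t := fun t ht =>
      mul_nonneg (hx.le.trans (le_of_lt ht)) (gaussianDensity_pos t).le
    have hint := integral_Ioi_of_hasDerivAt_of_nonneg' (a := x) (fun t _ => hd t) hnn hlim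
    have hi := integrableOn_Ioi_deriv_of_nonneg' (a := x) (fun t _ => hd t) hnn hlim
    have hle : ∫ t in Set.Ioi x, x * gaussianDensity t
        ≤ ∫ t in Set.Ioi x, t * gaussianDensity t :=
      setIntegral_mono_on (integrable_gaussianDensity.integrableOn.const_mul x) hi
        measurableSet_Ioi fun t ht =>
          mul_le_mul_of_nonneg_right (le_of_lt ht) (gaussianDensity_pos t).le
    rw [integral_const_mul, ← one_sub_gaussianCDF_eq_integral, hint] at hle
    linarith

theorem gaussianCDF_neg (x : ℝ) : gaussianCDF (-x) = 1 - gaussianCDF x := by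
  rw [one_sub_gaussianCDF_eq_integral, gaussianCDF_eq_integral]
  simpa [gaussianDensity_eq] using integral_comp_neg_Iic (-x) gaussianDensity

theorem neg_mul_gaussianCDF_le (x : ℝ) : -x * gaussianCDF x ≤ gaussianDensity x := by
  have h := mul_one_sub_gaussianCDF_le (-x)
  rw [gaussianCDF_neg] at h
  have : gaussianDensity (-x) = gaussianDensity x := by simp [gaussianDensity_eq]
  rw [this] at h
  linarith

end gaussian

/-! ### The solution of Stein's equation -/

/-- The bounded solution `f` of Stein's equation `f'(w) - w f(w) = 1{w < z} - Φ(z)`. -/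
noncomputable def steinSol (z w : ℝ) : ℝ :=
  gaussianCDF (min w z) * (1 - gaussianCDF (max w z)) / gaussianDensity w

/-- The right derivative of `steinSol z`, read off from Stein's equation. -/
noncomputable def steinDeriv (z w : ℝ) : ℝ :=
  w * steinSol z w + (if w < z then 1 else 0) - gaussianCDF z

theorem steinSol_nonneg (z w : ℝ) : 0 ≤ steinSol z w :=
  div_nonneg (mul_nonneg (gaussianCDF_nonneg _) (sub_nonneg.2 (gaussianCDF_le_one _)))
    (gaussianDensity_pos w).le

theorem steinSol_le (z w : ℝ) :
    steinSol z w ≤ gaussianCDF w * (1 - gaussianCDF w) / gaussianDensity w := by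
  have h1 := strictMono_gaussianCDF.monotone (min_le_left w z)
  have h2 := strictMono_gaussianCDF.monotone (le_max_left w z)
  have h3 := gaussianCDF_le_one (max w z)
  have h4 := gaussianCDF_nonneg w
  exact div_le_div_of_nonneg_right (mul_le_mul h1 (by linarith) (by linarith) h4)
    (gaussianDensity_pos w).le

theorem abs_mul_steinSol_le_one (z w : ℝ) : |w| * steinSol z w ≤ 1 := by
  refine (mul_le_mul_of_nonneg_left (steinSol_le z w) (abs_nonneg w)).trans ?_
  rw [← mul_div_assoc, div_le_one (gaussianDensity_pos w)]
  have h1 := mul_one_sub_gaussianCDF_le w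
  have h2 := neg_mul_gaussianCDF_le w
  have h3 := gaussianCDF_nonneg w
  have h4 := gaussianCDF_le_one w
  have h5 := gaussianDensity_pos w
  rcases abs_cases w with ⟨h, _⟩ | ⟨h, _⟩ <;> rw [h]
  · calc w * (gaussianCDF w * (1 - gaussianCDF w))
        = gaussianCDF w * (w * (1 - gaussianCDF w)) := by ring
      _ ≤ gaussianCDF w * gaussianDensity w := by gcongr
      _ ≤ gaussianDensity w := mul_le_of_le_one_left h5.le h4
  · calc -w * (gaussianCDF w * (1 - gaussianCDF w))
        = (1 - gaussianCDF w) * (-w * gaussianCDF w) := by ring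
      _ ≤ (1 - gaussianCDF w) * gaussianDensity w :=
          mul_le_mul_of_nonneg_left h2 (by linarith)
      _ ≤ gaussianDensity w := mul_le_of_le_one_left h5.le (by linarith)

/-- A uniform bound on the solutions of Stein's equation. -/
noncomputable def steinBound : ℝ := 1 + 1 / gaussianDensity 1

theorem steinBound_pos : 0 < steinBound := by
  have := gaussianDensity_pos 1
  unfold steinBound; positivity

theorem steinSol_le_steinBound (z w : ℝ) : steinSol z w ≤ steinBound := by
  have h1 := gaussianDensity_pos 1
  have h2 : 0 < 1 / gaussianDensity 1 := by positivity
  rcases le_total |w| 1 with h | h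
  · refine (steinSol_le z w).trans ?_
    have h3 := gaussianCDF_nonneg w
    have h4 := gaussianCDF_le_one w
    have h5 : gaussianCDF w * (1 - gaussianCDF w) / gaussianDensity w
        ≤ 1 / gaussianDensity 1 :=
      div_le_div₀ zero_le_one (by nlinarith) h1
        (gaussianDensity_anti_abs (by simpa using h))
    unfold steinBound; linarith
  · have h3 := abs_mul_steinSol_le_one z w
    have h4 := steinSol_nonneg z w
    unfold steinBound
    nlinarith

theorem abs_steinDeriv_le (z w : ℝ) : |steinDeriv z w| ≤ 2 := by
  have h1 := abs_mul_steinSol_le_one z w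
  rw [← abs_of_nonneg (steinSol_nonneg z w), ← abs_mul] at h1
  have h2 := gaussianCDF_nonneg z
  have h3 := gaussianCDF_le_one z
  rw [abs_le] at h1 ⊢
  unfold steinDeriv
  split_ifs <;> constructor <;> linarith

theorem continuous_steinSol (z : ℝ) : Continuous (steinSol z) := by
  unfold steinSol
  exact ((continuous_gaussianCDF.comp (continuous_id.min continuous_const)).mul
    (continuous_const.sub (continuous_gaussianCDF.comp
      (continuous_id.max continuous_const)))).div continuous_gaussianDensity
        fun w => (gaussianDensity_pos w).ne'

theorem hasDerivWithinAt_steinSol (z w : ℝ) :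
    HasDerivWithinAt (steinSol z) (steinDeriv z w) (Set.Ici w) w := by
  have hφ := gaussianDensity_pos w
  rcases lt_or_ge w z with h | h
  · have h1 : HasDerivAt (fun x => gaussianCDF x * (1 - gaussianCDF z) / gaussianDensity x)
        (steinDeriv z w) w := by
      refine HasDerivAt.congr_deriv (((hasDerivAt_gaussianCDF w).mul_const
        (1 - gaussianCDF z)).div (hasDerivAt_gaussianDensity w) hφ.ne') ?_
      simp only [steinDeriv, steinSol, h, if_true, min_eq_left h.le, max_eq_right h.le]
      field_simp
      ring
    refine (h1.congr_of_eventuallyEq ?_).hasDerivWithinAt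
    filter_upwards [Iio_mem_nhds h] with x hx
    have hx' : x ≤ z := le_of_lt hx
    simp [steinSol, min_eq_left hx', max_eq_right hx']
  · have h1 : HasDerivAt (fun x => gaussianCDF z * (1 - gaussianCDF x) / gaussianDensity x)
        (steinDeriv z w) w := by
      refine HasDerivAt.congr_deriv ((((hasDerivAt_gaussianCDF w).const_sub 1).const_mul
        (gaussianCDF z)).div (hasDerivAt_gaussianDensity w) hφ.ne') ?_
      simp only [steinDeriv, steinSol, not_lt.2 h, if_false, min_eq_right h, max_eq_left h]
      field_simp
      ring
    refine h1.hasDerivWithinAt.congr (fun x hx => ?_) ?_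
    · have hx' : z ≤ x := h.trans hx
      simp [steinSol, min_eq_right hx', max_eq_left hx']
    · simp [steinSol, min_eq_right h, max_eq_left h]

theorem abs_steinSol_sub_le (z x y : ℝ) : |steinSol z y - steinSol z x| ≤ 2 * |y - x| := by
  wlog hxy : x ≤ y generalizing x y
  · rw [abs_sub_comm, abs_sub_comm y]
    exact this y x (le_of_not_ge hxy)
  have h := norm_image_sub_le_of_norm_deriv_right_le_segment (f := steinSol z)
    (f' := steinDeriv z) (C := 2) (a := x) (b := y) (continuous_steinSol z).continuousOn
    (fun t _ => hasDerivWithinAt_steinSol z t) (fun t _ => abs_steinDeriv_le z t) y ⟨hxy, le_rfl⟩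
  rwa [Real.norm_eq_abs, ← abs_of_nonneg (sub_nonneg.2 hxy)] at h

/-- The modulus of continuity of `steinDeriv z` at scale `c`: away from the jump at `z` it is
Lipschitz with a constant growing linearly in `w`. -/
noncomputable def steinModulus (z c w : ℝ) : ℝ :=
  (steinBound + 2 * |w|) * c + (if z - c ≤ w ∧ w ≤ z + c then 1 else 0)

theorem abs_steinDeriv_sub_le (z w t c : ℝ) (ht : |t| ≤ c) :
    |steinDeriv z (w + t) - steinDeriv z w| ≤ steinModulus z c w := by
  have hc : 0 ≤ c := (abs_nonneg t).trans ht
  have h1 : |t * steinSol z (w + t)| ≤ steinBound * c := by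
    rw [abs_mul, abs_of_nonneg (steinSol_nonneg z _), mul_comm]
    exact mul_le_mul (steinSol_le_steinBound z _) ht (abs_nonneg t) steinBound_pos.le
  have h2 : |w * (steinSol z (w + t) - steinSol z w)| ≤ 2 * |w| * c := by
    rw [abs_mul]
    have := abs_steinSol_sub_le z w (w + t)
    rw [add_sub_cancel_left] at this
    nlinarith [abs_nonneg w]
  have h3 : |(if w + t < z then (1 : ℝ) else 0) - (if w < z then 1 else 0)|
      ≤ (if z - c ≤ w ∧ w ≤ z + c then 1 else 0) := by
    have := abs_le.1 ht
    by_cases hd : z - c ≤ w ∧ w ≤ z + c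
    · rw [if_pos hd]
      split_ifs <;> norm_num
    · have hiff : w + t < z ↔ w < z := by
        rw [not_and_or, not_le, not_le] at hd
        rcases hd with hd | hd
        · exact ⟨fun _ => by linarith, fun _ => by linarith⟩
        · exact ⟨fun _ => by linarith, fun _ => by linarith⟩
      simp only [if_neg hd, hiff, sub_self, abs_zero, le_refl]
  have h4 : steinDeriv z (w + t) - steinDeriv z w = t * steinSol z (w + t)
      + w * (steinSol z (w + t) - steinSol z w)
      + ((if w + t < z then (1 : ℝ) else 0) - (if w < z then 1 else 0)) := by
    unfold steinDeriv; ring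
  rw [h4]
  refine (abs_add_three _ _ _).trans ?_
  unfold steinModulus
  linarith

theorem abs_steinSol_taylor (z w y c : ℝ) (hy : |y| ≤ c) :
    |steinSol z (w + y) - steinSol z w - y * steinDeriv z w| ≤ |y| * steinModulus z c w := by
  set g : ℝ → ℝ := fun s => steinSol z s - s * steinDeriv z w with hg
  have hgc : Continuous g := (continuous_steinSol z).sub (continuous_id.mul continuous_const)
  have hgd : ∀ s, HasDerivWithinAt g (steinDeriv z s - steinDeriv z w) (Set.Ici s) s := by
    intro s
    exact ((hasDerivWithinAt_steinSol z s).sub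
      ((hasDerivWithinAt_id s (Set.Ici s)).mul_const (steinDeriv z w))).congr_deriv (by ring)
  have hb : ∀ s, |s - w| ≤ c → ‖steinDeriv z s - steinDeriv z w‖ ≤ steinModulus z c w := by
    intro s hs
    simpa using abs_steinDeriv_sub_le z w (s - w) c hs
  have he : steinSol z (w + y) - steinSol z w - y * steinDeriv z w = g (w + y) - g w := by
    simp only [hg]; ring
  rw [he]
  have hyc := abs_le.1 hy
  rcases le_total 0 y with h | h
  · have := norm_image_sub_le_of_norm_deriv_right_le_segment (a := w) (b := w + y)
      hgc.continuousOn (fun t _ => hgd t)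
      (fun t ht => hb t (abs_le.2 ⟨by linarith [ht.1], by linarith [ht.2]⟩)) (w + y)
      ⟨by linarith, le_rfl⟩
    rw [abs_of_nonneg h, mul_comm]
    simpa using this
  · have := norm_image_sub_le_of_norm_deriv_right_le_segment (a := w + y) (b := w)
      hgc.continuousOn (fun t _ => hgd t)
      (fun t ht => hb t (abs_le.2 ⟨by linarith [ht.1], by linarith [ht.2]⟩)) w
      ⟨by linarith, le_rfl⟩
    rw [abs_of_nonpos h, mul_comm, abs_sub_comm]
    simpa using this

/-! ### Expectations over finite alphabets -/

/-- The weighted sum `∑ z, w z * F z`, the expectation of `F` when `w` is a probability mass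
function. -/
noncomputable def expect {Ω : Type*} [Fintype Ω] (w F : Ω → ℝ) : ℝ := ∑ z, w z * F z

section expect

variable {Ω : Type*} [Fintype Ω] {w F G : Ω → ℝ}

theorem expect_mono (hw : ∀ z, 0 ≤ w z) (h : ∀ z, F z ≤ G z) : expect w F ≤ expect w G :=
  Finset.sum_le_sum fun z _ => mul_le_mul_of_nonneg_left (h z) (hw z)

theorem expect_nonneg (hw : ∀ z, 0 ≤ w z) (h : ∀ z, 0 ≤ F z) : 0 ≤ expect w F :=
  Finset.sum_nonneg fun z _ => mul_nonneg (hw z) (h z)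

theorem expect_add : expect w (fun z => F z + G z) = expect w F + expect w G := by
  simp only [expect, mul_add, Finset.sum_add_distrib]

theorem expect_sub : expect w (fun z => F z - G z) = expect w F - expect w G := by
  simp only [expect, mul_sub, Finset.sum_sub_distrib]

theorem expect_const_mul (r : ℝ) : expect w (fun z => r * F z) = r * expect w F := by
  simp only [expect, Finset.mul_sum, mul_left_comm]

theorem expect_mul_const (r : ℝ) : expect w (fun z => F z * r) = expect w F * r := by
  simp only [expect, Finset.sum_mul, mul_assoc]

theorem expect_const (hw : ∑ z, w z = 1) (r : ℝ) : expect w (fun _ => r) = r := by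
  simp only [expect, ← Finset.sum_mul, hw, one_mul]

theorem expect_sum {ι : Type*} (s : Finset ι) (F : ι → Ω → ℝ) :
    expect w (fun z => ∑ i ∈ s, F i z) = ∑ i ∈ s, expect w (F i) := by
  simp only [expect, Finset.mul_sum]
  exact Finset.sum_comm

theorem abs_expect_le (hw : ∀ z, 0 ≤ w z) : |expect w F| ≤ expect w (fun z => |F z|) :=
  (Finset.abs_sum_le_sum_abs _ _).trans_eq <|
    Finset.sum_congr rfl fun z _ => by rw [abs_mul, abs_of_nonneg (hw z)]

end expect

/-! ### Sums of independent identically distributed letters -/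

section iid

variable {Z : Type*}

/-- The additive functional `z ↦ ∑ i, Y (z i)` on words of length `n`. -/
def wordSum (Y : Z → ℝ) (n : ℕ) (z : Fin n → Z) : ℝ := ∑ i, Y (z i)

theorem wordSum_insertNth (Y : Z → ℝ) (n : ℕ) (i : Fin (n + 1)) (a : Z) (z : Fin n → Z) :
    wordSum Y (n + 1) (i.insertNth a z : Fin (n + 1) → Z) = Y a + wordSum Y n z := by
  simp [wordSum, Fin.sum_univ_succAbove _ i]

theorem wordSum_mul_const (X : Z → ℝ) (n : ℕ) (r : ℝ) (z : Fin n → Z) :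
    wordSum (fun a => X a * r) n z = wordSum X n z * r := by
  simp [wordSum, Finset.sum_mul]

theorem prodDist_insertNth (P : Z → ℝ) (n : ℕ) (i : Fin (n + 1)) (a : Z) (z : Fin n → Z) :
    prodDist P (n + 1) (i.insertNth a z : Fin (n + 1) → Z) = P a * prodDist P n z := by
  simp [prodDist, Fin.prod_univ_succAbove _ i]

variable [Fintype Z] {P : Z → ℝ}

theorem prodDist_nonneg (hP : P ∈ stdSimplex ℝ Z) (n : ℕ) (z : Fin n → Z) :
    0 ≤ prodDist P n z :=
  Finset.prod_nonneg fun i _ => hP.1 (z i)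

theorem sum_prodDist (hP : P ∈ stdSimplex ℝ Z) (n : ℕ) : ∑ z, prodDist P n z = 1 := by
  classical
  simp only [prodDist]
  rw [← Fintype.prod_sum (fun (_ : Fin n) a => P a)]
  simp [hP.2]

/-- Fubini's theorem for words, splitting off the letter at position `i`. -/
theorem expect_prodDist_succ (P : Z → ℝ) (n : ℕ) (i : Fin (n + 1))
    (F : (Fin (n + 1) → Z) → ℝ) :
    expect (prodDist P (n + 1)) F = expect P fun a => expect (prodDist P n) fun z =>
      F (i.insertNth a z : Fin (n + 1) → Z) := by
  have h := (Fin.insertNthEquiv (fun _ => Z) i).sum_comp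
    (fun z => prodDist P (n + 1) z * F z)
  rw [expect, ← h, Fintype.sum_prod_type]
  simp only [expect, Finset.mul_sum]
  refine Finset.sum_congr rfl fun a _ => Finset.sum_congr rfl fun z _ => ?_
  change prodDist P (n + 1) (i.insertNth a z : Fin (n + 1) → Z) * F (i.insertNth a z) = _
  rw [prodDist_insertNth, mul_assoc]

theorem expect_prodDist_succ_comp (P Y : Z → ℝ) (n : ℕ) (F : ℝ → ℝ) :
    expect (prodDist P (n + 1)) (fun z => F (wordSum Y (n + 1) z)) =
      expect P fun a => expect (prodDist P n) fun z => F (Y a + wordSum Y n z) := by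
  rw [expect_prodDist_succ P n 0]
  exact congrArg (expect P) <| funext fun a => congrArg (expect (prodDist P n)) <|
    funext fun z => congrArg F (wordSum_insertNth Y n 0 a z)

/-- Exchangeability: in `E[S F(S)]` every summand of the first factor contributes equally. -/
theorem expect_wordSum_mul (P Y : Z → ℝ) (n : ℕ) (F : ℝ → ℝ) :
    expect (prodDist P (n + 1)) (fun z => wordSum Y (n + 1) z * F (wordSum Y (n + 1) z)) =
      (n + 1) * expect P fun a => Y a * expect (prodDist P n) fun z =>
        F (Y a + wordSum Y n z) := by
  have h1 : ∀ i : Fin (n + 1), expect (prodDist P (n + 1))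
      (fun z => Y (z i) * F (wordSum Y (n + 1) z)) =
      expect P fun a => Y a * expect (prodDist P n) fun z => F (Y a + wordSum Y n z) := by
    intro i
    rw [expect_prodDist_succ P n i]
    simp only [wordSum_insertNth, Fin.insertNth_apply_same, expect_const_mul]
  have h2 : (fun z : Fin (n + 1) → Z => wordSum Y (n + 1) z * F (wordSum Y (n + 1) z)) =
      fun z => ∑ i, Y (z i) * F (wordSum Y (n + 1) z) := by
    funext z; rw [← Finset.sum_mul]; rfl
  rw [h2, expect_sum, Finset.sum_congr rfl fun i _ => h1 i]
  simp

/-- The variance of a sum of `n` centred independent letters. -/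
theorem expect_wordSum_sq (hP : P ∈ stdSimplex ℝ Z) {Y : Z → ℝ} (hY : expect P Y = 0) (n : ℕ) :
    expect (prodDist P n) (fun z => wordSum Y n z ^ 2) = n * expect P (fun a => Y a ^ 2) := by
  cases n with
  | zero => simp [wordSum, expect]
  | succ n =>
    have h := expect_wordSum_mul P Y n id
    simp only [id, expect_add, expect_const (sum_prodDist hP n), mul_add, expect_mul_const,
      hY, zero_mul, add_zero, ← pow_two] at h
    simpa using h

theorem expect_abs_wordSum_le_one (hP : P ∈ stdSimplex ℝ Z) {Y : Z → ℝ} {n m : ℕ}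
    (hY : expect P Y = 0) (hY2 : (m : ℝ) * expect P (fun a => Y a ^ 2) = 1) (hn : n ≤ m) :
    expect (prodDist P n) (fun z => |wordSum Y n z|) ≤ 1 := by
  have h1 : expect (prodDist P n) (fun z => |wordSum Y n z|) ≤
      expect (prodDist P n) (fun z => (1 + wordSum Y n z ^ 2) * (1 / 2)) := by
    refine expect_mono (prodDist_nonneg hP n) fun z => ?_
    nlinarith [sq_nonneg (|wordSum Y n z| - 1), sq_abs (wordSum Y n z)]
  rw [expect_mul_const, expect_add, expect_const (sum_prodDist hP n),
    expect_wordSum_sq hP hY] at h1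
  have h2 : (n : ℝ) * expect P (fun a => Y a ^ 2) ≤ m * expect P (fun a => Y a ^ 2) :=
    mul_le_mul_of_nonneg_right (by exact_mod_cast hn)
      (expect_nonneg hP.1 fun a => sq_nonneg _)
  linarith

/-- Stein's identity for `W = S + Y`, where `Y` is one of the `n + 1` letters. The subtracted term
`F(S)` contributes nothing because `Y` has mean zero and is independent of `S`. -/
theorem stein_identity {Y : Z → ℝ} (hY : expect P Y = 0) (n : ℕ) (F : ℝ → ℝ) :
    expect (prodDist P (n + 1)) (fun z => wordSum Y (n + 1) z * F (wordSum Y (n + 1) z)) =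
      expect P fun a => expect (prodDist P n) fun z =>
        (n + 1) * (Y a * (F (Y a + wordSum Y n z) - F (wordSum Y n z))) := by
  rw [expect_wordSum_mul]
  simp only [expect_const_mul, expect_sub, mul_sub, expect_mul_const, hY, zero_mul, sub_zero,
    mul_zero]

/-- Anti-concentration for sums of bounded, centred, independent letters. Testing Stein's identity
against the function that has slope one on `[a - c, b + c]` and is constant elsewhere bounds the
probability of `[a, b]` by half the length of the enlarged interval. -/
theorem expect_indicator_Icc_le (hP : P ∈ stdSimplex ℝ Z) {Y : Z → ℝ} {n : ℕ} {c : ℝ}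
    (hY : expect P Y = 0) (hY2 : ((n : ℝ) + 1) * expect P (fun a => Y a ^ 2) = 1)
    (hc : ∀ a, |Y a| ≤ c) (hc0 : 0 ≤ c) {a b : ℝ} (hab : a ≤ b) :
    expect (prodDist P n)
      (fun z => if a ≤ wordSum Y n z ∧ wordSum Y n z ≤ b then 1 else 0) ≤ (b - a) / 2 + c := by
  set h : ℝ := (b - a) / 2 + c with hh
  set f : ℝ → ℝ := fun s => max (-h) (min h (s - (a + b) / 2)) with hf
  have h0 : 0 ≤ h := by rw [hh]; linarith
  have hmono : Monotone f := fun s t hst =>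
    max_le_max le_rfl (min_le_min le_rfl (by linarith))
  have hbd : ∀ s, |f s| ≤ h := fun s =>
    abs_le.2 ⟨le_max_left _ _, max_le (by linarith) (min_le_left _ _)⟩
  have hid : ∀ s, a - c ≤ s → s ≤ b + c → f s = s - (a + b) / 2 := by
    intro s h1 h2
    simp only [hf]
    rw [min_eq_right (by rw [hh]; linarith), max_eq_right (by rw [hh]; linarith)]
  have hpt : ∀ (y s : ℝ), |y| ≤ c →
      y ^ 2 * (if a ≤ s ∧ s ≤ b then 1 else 0) ≤ y * (f (y + s) - f s) := by
    intro y s hy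
    have hy' := abs_le.1 hy
    split_ifs with hs
    · rw [hid s (by linarith) (by linarith), hid (y + s) (by linarith) (by linarith)]
      apply le_of_eq; ring
    · rw [mul_zero]
      rcases le_total 0 y with h1 | h1
      · exact mul_nonneg h1 (sub_nonneg.2 (hmono (by linarith)))
      · exact mul_nonneg_of_nonpos_of_nonpos h1 (sub_nonpos.2 (hmono (by linarith)))
  have hlow : expect (prodDist P n)
      (fun z => if a ≤ wordSum Y n z ∧ wordSum Y n z ≤ b then 1 else 0) ≤
      expect P fun a => expect (prodDist P n) fun z =>
        (n + 1) * (Y a * (f (Y a + wordSum Y n z) - f (wordSum Y n z))) := by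
    have h1 : expect P (fun y => expect (prodDist P n) fun z => ((n : ℝ) + 1) *
        (Y y ^ 2 * (if a ≤ wordSum Y n z ∧ wordSum Y n z ≤ b then 1 else 0))) ≤
        expect P fun a => expect (prodDist P n) fun z =>
          (n + 1) * (Y a * (f (Y a + wordSum Y n z) - f (wordSum Y n z))) :=
      expect_mono hP.1 fun y => expect_mono (prodDist_nonneg hP n) fun z =>
        mul_le_mul_of_nonneg_left (hpt _ _ (hc y)) (by positivity)
    simp only [expect_const_mul, expect_mul_const] at h1
    rw [← mul_assoc, hY2, one_mul] at h1
    simpa only [expect_const_mul] using h1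
  rw [← stein_identity hY] at hlow
  refine hlow.trans ?_
  have h2 : expect (prodDist P (n + 1))
      (fun z => wordSum Y (n + 1) z * f (wordSum Y (n + 1) z)) ≤
      expect (prodDist P (n + 1)) (fun z => |wordSum Y (n + 1) z| * h) :=
    expect_mono (prodDist_nonneg hP _) fun z => (le_abs_self _).trans <| by
      rw [abs_mul]; exact mul_le_mul_of_nonneg_left (hbd _) (abs_nonneg _)
  rw [expect_mul_const] at h2
  exact h2.trans (mul_le_of_le_one_left h0
    (expect_abs_wordSum_le_one hP hY (m := n + 1) (by exact_mod_cast hY2) le_rfl))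

/-- The **Berry–Esseen theorem** for sums of bounded letters, by Stein's method: the error in
Stein's equation is controlled by the modulus of continuity of `steinDeriv`, whose jump is absorbed
by the anti-concentration bound. -/
theorem berry_esseen (hP : P ∈ stdSimplex ℝ Z) {Y : Z → ℝ} {n : ℕ} {c : ℝ}
    (hY : expect P Y = 0) (hY2 : ((n : ℝ) + 1) * expect P (fun a => Y a ^ 2) = 1)
    (hc : ∀ a, |Y a| ≤ c) (hc0 : 0 ≤ c) (t : ℝ) :
    |expect (prodDist P (n + 1)) (fun z => if wordSum Y (n + 1) z < t then 1 else 0)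
      - gaussianCDF t| ≤ 2 * (steinBound + 4) * c := by
  have hmod : expect (prodDist P n) (fun z => steinModulus t c (wordSum Y n z))
      ≤ (steinBound + 4) * c := by
    simp only [steinModulus]
    rw [expect_add, expect_mul_const, expect_add, expect_const (sum_prodDist hP n),
      expect_const_mul]
    have h1 := expect_indicator_Icc_le hP hY hY2 hc hc0 (a := t - c) (b := t + c) (by linarith)
    have h2 := expect_abs_wordSum_le_one hP hY (n := n) (m := n + 1)
      (by exact_mod_cast hY2) (Nat.le_succ n)
    have h3 := mul_le_mul_of_nonneg_right h2 hc0
    linarith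
  have hstein : expect (prodDist P (n + 1))
        (fun z => if wordSum Y (n + 1) z < t then 1 else 0) - gaussianCDF t =
      expect (prodDist P (n + 1)) (fun z => steinDeriv t (wordSum Y (n + 1) z)) -
      expect (prodDist P (n + 1))
        (fun z => wordSum Y (n + 1) z * steinSol t (wordSum Y (n + 1) z)) := by
    simp only [steinDeriv]
    rw [expect_sub, expect_add, expect_const (sum_prodDist hP _)]
    ring
  rw [hstein, stein_identity hY, expect_prodDist_succ_comp P Y n (steinDeriv t), ← expect_sub]
  simp only [← expect_sub]
  have hpt : ∀ y s : ℝ, |y| ≤ c →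
      |(steinDeriv t (y + s) - (n + 1) * (y * (steinSol t (y + s) - steinSol t s)))
        - (1 - (n + 1) * y ^ 2) * steinDeriv t s|
      ≤ (1 + (n + 1) * y ^ 2) * steinModulus t c s := by
    intro y s hy
    have h1 := abs_steinDeriv_sub_le t s y c hy
    have h2 := abs_steinSol_taylor t s y c hy
    have h3 : |((n : ℝ) + 1) * y * (steinSol t (s + y) - steinSol t s - y * steinDeriv t s)|
        ≤ (n + 1) * y ^ 2 * steinModulus t c s := by
      rw [abs_mul, abs_mul, abs_of_nonneg (by positivity : (0 : ℝ) ≤ (n : ℝ) + 1), ← sq_abs y]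
      calc ((n : ℝ) + 1) * |y| * |steinSol t (s + y) - steinSol t s - y * steinDeriv t s|
          ≤ (n + 1) * |y| * (|y| * steinModulus t c s) := by gcongr
        _ = _ := by ring
    rw [add_comm s y] at h1 h2 h3
    have h4 : (steinDeriv t (y + s) - (n + 1) * (y * (steinSol t (y + s) - steinSol t s)))
        - (1 - (n + 1) * y ^ 2) * steinDeriv t s =
        (steinDeriv t (y + s) - steinDeriv t s)
        - (n + 1) * y * (steinSol t (y + s) - steinSol t s - y * steinDeriv t s) := by ring
    rw [h4]
    refine (abs_sub _ _).trans ?_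
    linarith
  have hzero : expect P (fun a => expect (prodDist P n) fun z =>
      (1 - ((n : ℝ) + 1) * Y a ^ 2) * steinDeriv t (wordSum Y n z)) = 0 := by
    simp only [expect_const_mul]
    rw [expect_mul_const, expect_sub, expect_const hP.2, expect_const_mul, hY2, sub_self, zero_mul]
  rw [← sub_zero (expect P _), ← hzero, ← expect_sub]
  simp only [← expect_sub]
  calc _ ≤ expect P (fun a => expect (prodDist P n) fun z =>
      (1 + ((n : ℝ) + 1) * Y a ^ 2) * steinModulus t c (wordSum Y n z)) :=
        (abs_expect_le hP.1).trans <| expect_mono hP.1 fun a =>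
          (abs_expect_le (prodDist_nonneg hP n)).trans <|
            expect_mono (prodDist_nonneg hP n) fun z => hpt _ _ (hc a)
    _ = 2 * expect (prodDist P n) (fun z => steinModulus t c (wordSum Y n z)) := by
        simp only [expect_const_mul]
        rw [expect_mul_const, expect_add, expect_const hP.2, expect_const_mul, hY2]
        norm_num
    _ ≤ _ := by linarith

end iid

/-! ### The estimates in unnormalized form -/

section unnormalized

variable {Z : Type*} [Fintype Z] {P X : Z → ℝ} {V M : ℝ}

/-- The normalization under which `m` independent copies have total variance one. -/
theorem normalized_moments (hX : expect P X = 0) (hV : expect P (fun a => X a ^ 2) = V)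
    (hV0 : 0 < V) (hM : ∀ a, |X a| ≤ M) {m : ℝ} (hm : 0 < m) :
    expect P (fun a => X a * (√(m * V))⁻¹) = 0 ∧
    m * expect P (fun a => (X a * (√(m * V))⁻¹) ^ 2) = 1 ∧
    (∀ a, |X a * (√(m * V))⁻¹| ≤ M * (√(m * V))⁻¹) := by
  have h : 0 < √(m * V) := Real.sqrt_pos.2 (by positivity)
  refine ⟨by rw [expect_mul_const, hX, zero_mul], ?_, fun a => ?_⟩
  · simp only [mul_pow]
    rw [expect_mul_const, hV, inv_pow, Real.sq_sqrt (by positivity)]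
    field_simp
  · rw [abs_mul, abs_of_pos (inv_pos.2 h)]
    exact mul_le_mul_of_nonneg_right (hM a) (inv_pos.2 h).le

theorem berry_esseen_unnormalized (hP : P ∈ stdSimplex ℝ Z) (hX : expect P X = 0)
    (hV : expect P (fun a => X a ^ 2) = V) (hV0 : 0 < V) (hM : ∀ a, |X a| ≤ M) (hM0 : 0 ≤ M)
    {n : ℕ} (hn : 0 < n) (x : ℝ) :
    |expect (prodDist P n) (fun z => if wordSum X n z < √(n * V) * x then 1 else 0)
      - gaussianCDF x| ≤ 2 * (steinBound + 4) * M / √V / √n := by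
  obtain ⟨k, rfl⟩ : ∃ k, n = k + 1 := ⟨n - 1, by omega⟩
  have hm : (0 : ℝ) < (k : ℝ) + 1 := by positivity
  obtain ⟨h1, h2, h3⟩ := normalized_moments hX hV hV0 hM hm
  have hs : 0 < √(((k : ℝ) + 1) * V) := Real.sqrt_pos.2 (by positivity)
  have h := berry_esseen hP h1 h2 h3 (by positivity) x
  simp only [wordSum_mul_const] at h
  simp only [← div_eq_mul_inv, div_lt_iff₀ hs, mul_comm x] at h
  push_cast
  refine h.trans_eq ?_
  rw [Real.sqrt_mul hm.le]
  field_simp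

theorem anti_concentration_unnormalized (hP : P ∈ stdSimplex ℝ Z) (hX : expect P X = 0)
    (hV : expect P (fun a => X a ^ 2) = V) (hV0 : 0 < V) (hM : ∀ a, |X a| ≤ M) (hM0 : 0 ≤ M)
    {n : ℕ} (hn : 0 < n) (x : ℝ) :
    expect (prodDist P n) (fun z => if x ≤ wordSum X n z ∧ wordSum X n z ≤ x + 1 then 1 else 0)
      ≤ (1 / 2 + M) / √V / √n := by
  have hm : (0 : ℝ) < (n : ℝ) + 1 := by positivity
  have hn' : (0 : ℝ) < n := by exact_mod_cast hn
  obtain ⟨h1, h2, h3⟩ := normalized_moments hX hV hV0 hM hm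
  have hs : 0 < √(((n : ℝ) + 1) * V) := Real.sqrt_pos.2 (by positivity)
  have h := expect_indicator_Icc_le hP h1 h2 h3 (by positivity)
    (a := x * (√(((n : ℝ) + 1) * V))⁻¹) (b := (x + 1) * (√(((n : ℝ) + 1) * V))⁻¹)
    (mul_le_mul_of_nonneg_right (by linarith) (inv_pos.2 hs).le)
  simp only [wordSum_mul_const, mul_le_mul_iff_left₀ (inv_pos.2 hs)] at h
  refine h.trans ?_
  have h4 : ((x + 1) * (√(((n : ℝ) + 1) * V))⁻¹ - x * (√(((n : ℝ) + 1) * V))⁻¹) / 2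
      + M * (√(((n : ℝ) + 1) * V))⁻¹ = (1 / 2 + M) / √(((n : ℝ) + 1) * V) := by
    field_simp; ring
  rw [h4, div_div, ← Real.sqrt_mul hV0.le, mul_comm V]
  have : (0 : ℝ) < √(n * V) := Real.sqrt_pos.2 (by positivity)
  gcongr
  linarith

end unnormalized

/-! ### Likelihood-ratio tests -/

section tests

variable {Z : Type*} {P Q : Z → ℝ}

/-- The log-likelihood ratio of a letter, in bits. -/
noncomputable def llr (P Q : Z → ℝ) (z : Z) : ℝ := Real.logb 2 (P z / Q z)

theorem mul_two_rpow_neg_llr (hP : ∀ z, 0 ≤ P z) (hQ : ∀ z, 0 ≤ Q z)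
    (hPQ : ∀ z, Q z = 0 → P z = 0) {z : Z} (hz : P z ≠ 0) :
    P z * (2 : ℝ) ^ (-llr P Q z) = Q z := by
  have h1 : 0 < P z := lt_of_le_of_ne (hP z) hz.symm
  have h2 : 0 < Q z := lt_of_le_of_ne (hQ z) fun h => hz (hPQ z h.symm)
  rw [llr, Real.rpow_neg two_pos.le, Real.rpow_logb two_pos (by norm_num) (div_pos h1 h2)]
  field_simp

theorem prodDist_mul_two_rpow (P Q : Z → ℝ) (n : ℕ) (z : Fin n → Z) :
    prodDist P n z * (2 : ℝ) ^ (-wordSum (llr P Q) n z) =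
      ∏ i, (P (z i) * (2 : ℝ) ^ (-llr P Q (z i))) := by
  rw [Finset.prod_mul_distrib, ← Real.rpow_sum_of_pos two_pos, Finset.sum_neg_distrib]
  rfl

/-- Change of measure from `Qⁿ` to `Pⁿ`: equality on the support of `Pⁿ`. -/
theorem prodDist_mul_two_rpow_eq (hP : ∀ z, 0 ≤ P z) (hQ : ∀ z, 0 ≤ Q z)
    (hPQ : ∀ z, Q z = 0 → P z = 0) {n : ℕ} {z : Fin n → Z} (hz : prodDist P n z ≠ 0) :
    prodDist P n z * (2 : ℝ) ^ (-wordSum (llr P Q) n z) = prodDist Q n z := by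
  rw [prodDist_mul_two_rpow]
  exact Finset.prod_congr rfl fun i hi =>
    mul_two_rpow_neg_llr hP hQ hPQ (Finset.prod_ne_zero_iff.1 hz i hi)

theorem prodDist_mul_two_rpow_le (hP : ∀ z, 0 ≤ P z) (hQ : ∀ z, 0 ≤ Q z)
    (hPQ : ∀ z, Q z = 0 → P z = 0) (n : ℕ) (z : Fin n → Z) :
    prodDist P n z * (2 : ℝ) ^ (-wordSum (llr P Q) n z) ≤ prodDist Q n z := by
  by_cases hz : prodDist P n z = 0
  · rw [hz, zero_mul]
    exact Finset.prod_nonneg fun i _ => hQ (z i)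
  · exact (prodDist_mul_two_rpow_eq hP hQ hPQ hz).le

variable [Fintype Z]

/-- Converse bound: no test beats `2^{-γ} (Pⁿ[L < γ] - ε)`, for any threshold `γ` on the
log-likelihood ratio `L`. -/
theorem le_minTypeTwoError (hP : P ∈ stdSimplex ℝ Z) (hQ : Q ∈ stdSimplex ℝ Z)
    (hPQ : ∀ z, Q z = 0 → P z = 0) {ε : ℝ} (hε : 0 ≤ ε) (n : ℕ) (γ : ℝ) :
    (2 : ℝ) ^ (-γ) * (expect (prodDist P n)
      (fun z => if wordSum (llr P Q) n z < γ then 1 else 0) - ε) ≤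
      minTypeTwoError ε (prodDist P n) (prodDist Q n) := by
  refine le_csInf ⟨_, 0, ⟨fun z => by simp, by simpa using hε⟩, rfl⟩ ?_
  rintro _ ⟨δ, ⟨hδ, hδε⟩, rfl⟩
  have hpow : (0 : ℝ) < 2 ^ (-γ) := Real.rpow_pos_of_pos two_pos _
  have hpt : ∀ z, prodDist P n z *
      (2 ^ (-γ) * ((if wordSum (llr P Q) n z < γ then 1 else 0) - δ z)) ≤
      prodDist Q n z * (1 - δ z) := by
    intro z
    have hp := prodDist_nonneg hP n z
    have hq := prodDist_nonneg hQ n z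
    have h1 : 0 ≤ 1 - δ z := sub_nonneg.2 (hδ z).2
    split_ifs with h
    · have h2 : (2 : ℝ) ^ (-γ) ≤ 2 ^ (-wordSum (llr P Q) n z) :=
        Real.rpow_le_rpow_of_exponent_le one_le_two (by linarith)
      rw [← mul_assoc]
      exact mul_le_mul_of_nonneg_right ((mul_le_mul_of_nonneg_left h2 hp).trans
        (prodDist_mul_two_rpow_le hP.1 hQ.1 hPQ n z)) h1
    · refine le_trans ?_ (mul_nonneg hq h1)
      exact mul_nonpos_of_nonneg_of_nonpos hp (mul_nonpos_of_nonneg_of_nonpos hpow.le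
        (by linarith [(hδ z).1]))
  have hsum := Finset.sum_le_sum fun z (_ : z ∈ Finset.univ) => hpt z
  refine le_trans ?_ hsum
  change _ ≤ expect (prodDist P n) _
  rw [expect_const_mul, expect_sub]
  have : expect (prodDist P n) δ ≤ ε := hδε
  gcongr

theorem minTypeTwoError_pos (hP : P ∈ stdSimplex ℝ Z) (hQ : Q ∈ stdSimplex ℝ Z)
    (hPQ : ∀ z, Q z = 0 → P z = 0) {ε : ℝ} (hε : ε ∈ Set.Ioo (0 : ℝ) 1) (n : ℕ) :
    0 < minTypeTwoError ε (prodDist P n) (prodDist Q n) := by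
  obtain ⟨B, hB⟩ := (Set.finite_range (wordSum (llr P Q) n)).bddAbove
  refine lt_of_lt_of_le ?_ (le_minTypeTwoError hP hQ hPQ hε.1.le n (B + 1))
  have h : ∀ z, wordSum (llr P Q) n z < B + 1 := fun z =>
    (hB (Set.mem_range_self z)).trans_lt (lt_add_one B)
  simp only [h, if_true, expect_const (sum_prodDist hP n)]
  exact mul_pos (Real.rpow_pos_of_pos two_pos _) (sub_pos.2 hε.2)

/-- Achievability bound, for the test that decides against `P` when `L < γ`. Cutting the region
`L ≥ γ` into unit slabs, on which `2^{-L}` decays geometrically, leaves twice the bound `p` for the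
probability of a single slab. -/
theorem minTypeTwoError_le (hP : P ∈ stdSimplex ℝ Z) (hQ : Q ∈ stdSimplex ℝ Z)
    (hPQ : ∀ z, Q z = 0 → P z = 0) {ε : ℝ} {n : ℕ} {γ p : ℝ}
    (hγ : expect (prodDist P n) (fun z => if wordSum (llr P Q) n z < γ then 1 else 0) ≤ ε)
    (hp : ∀ x, expect (prodDist P n) (fun z =>
      if x ≤ wordSum (llr P Q) n z ∧ wordSum (llr P Q) n z ≤ x + 1 then 1 else 0) ≤ p) :
    minTypeTwoError ε (prodDist P n) (prodDist Q n) ≤ 2 * p * 2 ^ (-γ) := by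
  classical
  -- Words outside the support of `Pⁿ` are rejected too: this is free under `Pⁿ`.
  set δ : (Fin n → Z) → ℝ :=
    fun z => if wordSum (llr P Q) n z < γ ∨ prodDist P n z = 0 then 1 else 0 with hδ
  have hp0 : 0 ≤ p := (expect_nonneg (prodDist_nonneg hP n)
    fun z => by split_ifs <;> norm_num).trans (hp 0)
  have hadm : δ ∈ admissibleTests ε (prodDist P n) := by
    refine ⟨fun z => ?_, ?_⟩
    · simp only [hδ]; split_ifs <;> norm_num
    · refine le_trans (le_of_eq ?_) hγ
      refine Finset.sum_congr rfl fun z _ => ?_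
      by_cases hz : prodDist P n z = 0
      · simp [hz]
      · simp [hδ, hz]
  have hbdd : BddBelow ((fun δ : (Fin n → Z) → ℝ => ∑ z, prodDist Q n z * (1 - δ z)) ''
      admissibleTests ε (prodDist P n)) := by
    refine ⟨0, ?_⟩
    rintro _ ⟨η, hη, rfl⟩
    exact Finset.sum_nonneg fun z _ =>
      mul_nonneg (prodDist_nonneg hQ n z) (sub_nonneg.2 (hη.1 z).2)
  refine (csInf_le hbdd ⟨δ, hadm, rfl⟩).trans ?_
  obtain ⟨B, hB⟩ := (Set.finite_range (wordSum (llr P Q) n)).bddAbove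
  obtain ⟨K, hK⟩ := exists_nat_gt (B - γ)
  have hpow : (0 : ℝ) < 2 ^ (-γ) := Real.rpow_pos_of_pos two_pos _
  have hterm : ∀ z (k : ℕ), 0 ≤ (2 : ℝ) ^ (-γ) * (1 / 2) ^ k *
      (if γ + k ≤ wordSum (llr P Q) n z ∧ wordSum (llr P Q) n z ≤ γ + k + 1 then 1 else 0) := by
    intro z k
    split_ifs <;> positivity
  have hpt : ∀ z, prodDist Q n z * (1 - δ z) ≤ prodDist P n z *
      ∑ k ∈ Finset.range K, (2 : ℝ) ^ (-γ) * (1 / 2) ^ k *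
      (if γ + k ≤ wordSum (llr P Q) n z ∧ wordSum (llr P Q) n z ≤ γ + k + 1 then 1 else 0) := by
    intro z
    by_cases hz : wordSum (llr P Q) n z < γ ∨ prodDist P n z = 0
    · simp only [hδ, hz, if_true, sub_self, mul_zero]
      exact mul_nonneg (prodDist_nonneg hP n z) (Finset.sum_nonneg fun k _ => hterm z k)
    · simp only [hδ, hz, if_false, sub_zero, mul_one]
      push Not at hz
      rw [← prodDist_mul_two_rpow_eq hP.1 hQ.1 hPQ hz.2]
      refine mul_le_mul_of_nonneg_left ?_ (prodDist_nonneg hP n z)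
      set k := ⌊wordSum (llr P Q) n z - γ⌋₊ with hk
      have hk1 : (k : ℝ) ≤ wordSum (llr P Q) n z - γ := Nat.floor_le (by linarith [hz.1])
      have hk2 : wordSum (llr P Q) n z - γ < k + 1 := Nat.lt_floor_add_one _
      have hkK : k ∈ Finset.range K := by
        rw [Finset.mem_range]
        have h1 : wordSum (llr P Q) n z ≤ B := hB (Set.mem_range_self z)
        have h2 : (k : ℝ) < K := by linarith
        exact_mod_cast h2
      refine le_trans ?_ (Finset.single_le_sum (fun k _ => hterm z k) hkK)
      rw [if_pos ⟨by linarith, by linarith⟩, mul_one]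
      calc (2 : ℝ) ^ (-wordSum (llr P Q) n z) ≤ 2 ^ (-γ + -(k : ℝ)) :=
            Real.rpow_le_rpow_of_exponent_le one_le_two (by linarith)
        _ = 2 ^ (-γ) * (1 / 2) ^ k := by
            rw [Real.rpow_add two_pos, Real.rpow_neg two_pos.le (k : ℝ), Real.rpow_natCast,
              one_div, inv_pow]
  refine (Finset.sum_le_sum fun z _ => hpt z).trans ?_
  change expect (prodDist P n) _ ≤ _
  rw [expect_sum]
  simp only [expect_const_mul]
  calc _ ≤ ∑ k ∈ Finset.range K, (2 : ℝ) ^ (-γ) * (1 / 2) ^ k * p :=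
        Finset.sum_le_sum fun k _ => mul_le_mul_of_nonneg_left (hp _) (by positivity)
    _ = (∑ k ∈ Finset.range K, (1 / 2 : ℝ) ^ k) * (p * 2 ^ (-γ)) := by
        rw [Finset.sum_mul]
        exact Finset.sum_congr rfl fun k _ => by ring
    _ ≤ 2 * (p * 2 ^ (-γ)) :=
        mul_le_mul_of_nonneg_right (sum_geometric_two_le K) (by positivity)
    _ = _ := by ring

end tests

/-! ### Third-order asymptotics of the optimal type-II error -/

/-- `Φ` grows at least linearly on the unit neighbourhood of any point. -/
theorem gaussianCDF_growth {x₀ x y : ℝ} (hx : x₀ - 1 ≤ x) (hxy : x ≤ y) (hy : y ≤ x₀ + 1) :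
    gaussianDensity (|x₀| + 1) * (y - x) ≤ gaussianCDF y - gaussianCDF x := by
  refine (convex_Icc (x₀ - 1) (x₀ + 1)).mul_sub_le_image_sub_of_le_deriv
    continuous_gaussianCDF.continuousOn
    (fun t _ => (hasDerivAt_gaussianCDF t).differentiableAt.differentiableWithinAt)
    (fun t ht => ?_) x ⟨hx, by linarith⟩ y ⟨by linarith, hy⟩ hxy
  rw [interior_Icc] at ht
  rw [(hasDerivAt_gaussianCDF t).deriv]
  refine gaussianDensity_anti_abs ?_
  rw [abs_of_nonneg (by positivity : 0 ≤ |x₀| + 1), abs_le]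
  have h1 := le_abs_self x₀
  have h2 := neg_abs_le x₀
  exact ⟨by linarith [ht.1], by linarith [ht.2]⟩

section asymptotics

variable {Z : Type*} [Fintype Z] {P Q : Z → ℝ}

/-- Berry–Esseen and anti-concentration bounds, with the rate `n^{-1/2}`, for the log-likelihood
ratio of words of length `n`. -/
theorem exists_llr_bounds (hP : P ∈ stdSimplex ℝ Z) (hV : 0 < relEntropyVariance P Q) :
    ∃ B : ℝ, 0 < B ∧ ∀ n : ℕ, 0 < n →
      (∀ x, |expect (prodDist P n) (fun z => if wordSum (llr P Q) n z <
        n * relEntropy P Q + √(n * relEntropyVariance P Q) * x then 1 else 0)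
        - gaussianCDF x| ≤ B / √n) ∧
      (∀ x, expect (prodDist P n) (fun z => if x ≤ wordSum (llr P Q) n z ∧
        wordSum (llr P Q) n z ≤ x + 1 then 1 else 0) ≤ B / √n) := by
  set D := relEntropy P Q with hD
  set V := relEntropyVariance P Q with hVdef
  set X : Z → ℝ := fun a => llr P Q a - D with hX
  have hX0 : expect P X = 0 := by
    rw [hX, expect_sub, expect_const hP.2]
    exact sub_self D
  have hX2 : expect P (fun a => X a ^ 2) = V := rfl
  set M : ℝ := ∑ a, |X a| with hM
  have hM0 : 0 ≤ M := Finset.sum_nonneg fun a _ => abs_nonneg _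
  have hXM : ∀ a, |X a| ≤ M := fun a =>
    Finset.single_le_sum (f := fun a => |X a|) (fun a _ => abs_nonneg _) (Finset.mem_univ a)
  have hL : ∀ (n : ℕ) (z : Fin n → Z), wordSum (llr P Q) n z = wordSum X n z + n * D := by
    intro n z
    simp [wordSum, hX, Finset.sum_sub_distrib]
  have hs : 0 < √V := Real.sqrt_pos.2 hV
  have hK := steinBound_pos
  refine ⟨2 * (steinBound + 4) * M / √V + (1 / 2 + M) / √V, by positivity,
    fun n hn => ⟨fun x => ?_, fun x => ?_⟩⟩
  · have h := berry_esseen_unnormalized hP hX0 hX2 hV hXM hM0 hn x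
    simp only [hL, add_comm (n * D), add_lt_add_iff_right]
    refine h.trans ?_
    gcongr
    exact le_add_of_nonneg_right (by positivity)
  · have h := anti_concentration_unnormalized hP hX0 hX2 hV hXM hM0 hn (x - n * D)
    have he : ∀ z : Fin n → Z, (x ≤ wordSum (llr P Q) n z ∧ wordSum (llr P Q) n z ≤ x + 1) ↔
        (x - n * D ≤ wordSum X n z ∧ wordSum X n z ≤ x - n * D + 1) := by
      intro z
      rw [hL]
      exact and_congr ⟨fun h => by linarith, fun h => by linarith⟩
        ⟨fun h => by linarith, fun h => by linarith⟩
    simp only [he]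
    refine h.trans ?_
    gcongr
    exact le_add_of_nonneg_left (by positivity)

/-- The expansion of `-log₂ β`. Moving the threshold by a constant `A` away from
`n D + √(n V) Φ⁻¹(ε)` changes the type-I error by more than the Berry–Esseen error. -/
theorem exists_abs_logb_minTypeTwoError_le (hP : P ∈ stdSimplex ℝ Z) (hQ : Q ∈ stdSimplex ℝ Z)
    (hPQ : ∀ z, Q z = 0 → P z = 0) (hV : 0 < relEntropyVariance P Q)
    {ε : ℝ} (hε : ε ∈ Set.Ioo (0 : ℝ) 1) :
    ∃ C : ℝ, ∀ᶠ n : ℕ in atTop,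
      |-Real.logb 2 (minTypeTwoError ε (prodDist P n) (prodDist Q n)) -
        (n * relEntropy P Q + √(n * relEntropyVariance P Q) * gaussianCDFInv ε
          + 1 / 2 * Real.logb 2 n)| ≤ C := by
  obtain ⟨B, hB, hbound⟩ := exists_llr_bounds (Q := Q) hP hV
  set D := relEntropy P Q
  set V := relEntropyVariance P Q
  set x₀ := gaussianCDFInv ε with hx₀
  have hΦ : gaussianCDF x₀ = ε := gaussianCDF_gaussianCDFInv hε
  set κ := gaussianDensity (|x₀| + 1) with hκdef
  have hκ : 0 < κ := gaussianDensity_pos _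
  set A := √V * ((B + 1) / κ) with hA
  refine ⟨A + 1 + |Real.logb 2 B|, ?_⟩
  have hev : ∀ᶠ n : ℕ in atTop, (B + 1) / κ ≤ √n :=
    (Real.tendsto_sqrt_atTop.comp tendsto_natCast_atTop_atTop).eventually_ge_atTop _
  filter_upwards [hev, eventually_gt_atTop 0] with n hn1 hn
  obtain ⟨hbe, hac⟩ := hbound n hn
  have hn' : (0 : ℝ) < n := by exact_mod_cast hn
  have hsn : 0 < √(n : ℝ) := Real.sqrt_pos.2 hn'
  -- The displacement `A` of the threshold, measured in standard deviations.
  set t := (B + 1) / κ / √n with ht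
  have ht0 : 0 ≤ t := by positivity
  have ht1 : t ≤ 1 := (div_le_one hsn).2 hn1
  have hκt : κ * t = B / √n + 1 / √n := by rw [ht]; field_simp
  have hAt : √(n * V) * t = A := by
    rw [ht, hA, Real.sqrt_mul hn'.le]; field_simp
  have hlogn : Real.logb 2 (√n) = 1 / 2 * Real.logb 2 n := by
    rw [Real.sqrt_eq_rpow, Real.logb_rpow_eq_mul_logb_of_pos hn']
  have hβ := minTypeTwoError_pos hP hQ hPQ hε n
  set β := minTypeTwoError ε (prodDist P n) (prodDist Q n)
  have hinv : (0 : ℝ) < 1 / √n := by positivity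
  -- `β ≥ 2 ^ (-γ) / √n` for the threshold displaced upwards.
  have hlow : -Real.logb 2 β ≤ n * D + √(n * V) * x₀ + A + 1 / 2 * Real.logb 2 n := by
    set γ := n * D + √(n * V) * (x₀ + t) with hγ
    have h1 := (abs_le.1 (hbe (x₀ + t))).1
    have h2 := gaussianCDF_growth (x₀ := x₀) (x := x₀) (y := x₀ + t)
      (by linarith) (by linarith) (by linarith)
    rw [add_sub_cancel_left, ← hκdef, hκt, hΦ] at h2
    have h3 := le_minTypeTwoError hP hQ hPQ hε.1.le n γ
    have hpow : (0 : ℝ) < 2 ^ (-γ) := Real.rpow_pos_of_pos two_pos _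
    have h4 : (2 : ℝ) ^ (-γ) * (1 / √n) ≤ β :=
      (mul_le_mul_of_nonneg_left (by linarith) hpow.le).trans h3
    have h5 := Real.logb_le_logb_of_le one_lt_two (mul_pos hpow hinv) h4
    rw [Real.logb_mul hpow.ne' hinv.ne', Real.logb_rpow two_pos (by norm_num), one_div,
      Real.logb_inv, hlogn] at h5
    have h6 : γ = n * D + √(n * V) * x₀ + A := by rw [hγ, ← hAt]; ring
    linarith
  -- `β ≤ 2 * (B / √n) * 2 ^ (-γ)` for the threshold displaced downwards.
  have hup : n * D + √(n * V) * x₀ - A + 1 / 2 * Real.logb 2 n - 1 - Real.logb 2 B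
      ≤ -Real.logb 2 β := by
    set γ := n * D + √(n * V) * (x₀ - t) with hγ
    have h1 := (abs_le.1 (hbe (x₀ - t))).2
    have h2 := gaussianCDF_growth (x₀ := x₀) (x := x₀ - t) (y := x₀)
      (by linarith) (by linarith) (by linarith)
    rw [sub_sub_cancel, ← hκdef, hκt, hΦ] at h2
    have h3 := minTypeTwoError_le (ε := ε) (γ := γ) hP hQ hPQ (by linarith) hac
    have hpow : (0 : ℝ) < 2 ^ (-γ) := Real.rpow_pos_of_pos two_pos _
    have hBn : (0 : ℝ) < B / √n := by positivity
    have h5 := Real.logb_le_logb_of_le one_lt_two hβ h3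
    rw [Real.logb_mul (by positivity) hpow.ne', Real.logb_mul two_ne_zero hBn.ne',
      Real.logb_rpow two_pos (by norm_num), Real.logb_div hB.ne' hsn.ne', hlogn,
      Real.logb_self_eq_one one_lt_two] at h5
    have h6 : γ = n * D + √(n * V) * x₀ - A := by rw [hγ, ← hAt]; ring
    linarith
  have h7 := le_abs_self (Real.logb 2 B)
  have h8 := abs_nonneg (Real.logb 2 B)
  rw [abs_le]
  constructor <;> linarith

end asymptotics

/-- A sequence with an expansion `n D + √(n V) x + ½ log₂ n + O(1)` has growth rate `D`. -/
theorem tendsto_div_of_expansion {u : ℕ → ℝ} {D V x : ℝ}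
    (h : (fun n : ℕ => u n - (n * D + √(n * V) * x + 1 / 2 * Real.logb 2 n))
      =O[atTop] (fun _ : ℕ => (1 : ℝ))) :
    Tendsto (fun n : ℕ => u n / n) atTop (𝓝 D) := by
  have hid : Tendsto (fun n : ℕ => (n : ℝ)) atTop atTop := tendsto_natCast_atTop_atTop
  have h1 : Tendsto (fun n : ℕ =>
      (u n - (n * D + √(n * V) * x + 1 / 2 * Real.logb 2 n)) / n) atTop (𝓝 0) :=
    (h.trans_isLittleO ((isLittleO_const_id_atTop (1 : ℝ)).comp_tendsto hid)).tendsto_div_nhds_zero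
  have h2 : Tendsto (fun n : ℕ => √V * x * (√(n : ℝ))⁻¹) atTop (𝓝 0) := by
    simpa using (tendsto_inv_atTop_zero.comp (Real.tendsto_sqrt_atTop.comp hid)).const_mul (√V * x)
  have h3 : Tendsto (fun n : ℕ => 1 / 2 / Real.log 2 * (Real.log n / n)) atTop (𝓝 0) := by
    simpa using ((Real.isLittleO_log_id_atTop.comp_tendsto hid).tendsto_div_nhds_zero).const_mul
      (1 / 2 / Real.log 2)
  have h4 := ((h1.add h2).add h3).add_const D
  rw [add_zero, add_zero, zero_add] at h4
  refine h4.congr' ?_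
  filter_upwards [eventually_gt_atTop 0] with n hn
  have hn' : (0 : ℝ) < n := by exact_mod_cast hn
  have hsn : 0 < √(n : ℝ) := Real.sqrt_pos.2 hn'
  have h5 : (√(n : ℝ))⁻¹ = √n / n := by rw [Real.sqrt_div_self', one_div]
  rw [h5, Real.sqrt_mul hn'.le, Real.logb]
  field_simp
  ring

end HypothesisTesting

theorem mainTheorem1 {Z : Type*} [Fintype Z] (P Q : Z → ℝ)
    (hP : P ∈ stdSimplex ℝ Z) (hQ : Q ∈ stdSimplex ℝ Z)
    (hPQ : ∀ z, Q z = 0 → P z = 0)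
    (hV : 0 < HypothesisTesting.relEntropyVariance P Q)
    (ε : ℝ) (hε : ε ∈ Set.Ioo (0 : ℝ) 1) :
    -- every `D_h^ε(Pⁿ‖Qⁿ)` is finite
    (∀ n : ℕ, 0 < HypothesisTesting.minTypeTwoError ε
      (HypothesisTesting.prodDist P n) (HypothesisTesting.prodDist Q n)) ∧
    -- third-order expansion of `D_h^ε(Pⁿ‖Qⁿ)`
    ((fun n : ℕ =>
        HypothesisTesting.hypTestDiv ε
            (HypothesisTesting.prodDist P n) (HypothesisTesting.prodDist Q n)
          - ((n : ℝ) * HypothesisTesting.relEntropy P Q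
              + √((n : ℝ) * HypothesisTesting.relEntropyVariance P Q)
                  * HypothesisTesting.gaussianCDFInv ε
              + 1 / 2 * Real.logb 2 (n : ℝ)))
      =O[atTop] (fun _ : ℕ => (1 : ℝ))) ∧
    -- Chernoff–Stein lemma
    Tendsto (fun n : ℕ => 1 / (n : ℝ) * Real.logb 2 (1 / HypothesisTesting.minTypeTwoError ε
        (HypothesisTesting.prodDist P n) (HypothesisTesting.prodDist Q n)))
      atTop (𝓝 (HypothesisTesting.relEntropy P Q)) ∧
    Tendsto (fun n : ℕ => HypothesisTesting.hypTestDiv ε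
        (HypothesisTesting.prodDist P n) (HypothesisTesting.prodDist Q n) / (n : ℝ))
      atTop (𝓝 (HypothesisTesting.relEntropy P Q)) := by
  open HypothesisTesting in
  have hpos := minTypeTwoError_pos hP hQ hPQ hε
  obtain ⟨C, hC⟩ := exists_abs_logb_minTypeTwoError_le hP hQ hPQ hV hε
  have hβ : (fun n : ℕ => -Real.logb 2 (minTypeTwoError ε (prodDist P n) (prodDist Q n)) -
        (n * relEntropy P Q + √(n * relEntropyVariance P Q) * gaussianCDFInv ε
          + 1 / 2 * Real.logb 2 n)) =O[atTop] (fun _ : ℕ => (1 : ℝ)) :=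
    IsBigO.of_bound C (hC.mono fun n hn => by simpa using hn)
  have hdiv : ∀ n : ℕ, hypTestDiv ε (prodDist P n) (prodDist Q n) =
      -Real.logb 2 (minTypeTwoError ε (prodDist P n) (prodDist Q n)) + Real.logb 2 (1 - ε) := by
    intro n
    rw [hypTestDiv, Real.logb_div (hpos n).ne' (sub_pos.2 hε.2).ne']
    ring
  have hD : (fun n : ℕ => hypTestDiv ε (prodDist P n) (prodDist Q n) -
        (n * relEntropy P Q + √(n * relEntropyVariance P Q) * gaussianCDFInv ε
          + 1 / 2 * Real.logb 2 n)) =O[atTop] (fun _ : ℕ => (1 : ℝ)) := by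
    refine (hβ.add (isBigO_const_const (Real.logb 2 (1 - ε)) one_ne_zero atTop)).congr_left
      fun n => ?_
    rw [hdiv]
    ring
  refine ⟨hpos, hD, (tendsto_div_of_expansion hβ).congr fun n => ?_, tendsto_div_of_expansion hD⟩
  rw [one_div (minTypeTwoError ε _ _), Real.logb_inv]
  ring
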